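/- Consider two-arm Bernoulli bandits: an instance is $\mu=(\mu_1,\mu_2)\in(0,1)^2$ with $\mu_1\neq\mu_2$, and each pull of arm $i$ yields an independent Bernoulli reward of mean $\mu_i$. Given a budget $T\in\mathbb{N}$, an algorithm pulls one arm in each of $T$ rounds, the choice (possibly randomized) depending only on $T$ and on the arms pulled and rewards observed before, and after round $T$ it recommends an arm $\hat\imath_T$ (again possibly at random) depending only on $T$ and on the observations. Its error probability is $p_{\mu,T}=\mathbb{P}_\mu(\hat\imath_T\notin\arg\max_i\mu_i)$ and its error exponent on $\mu$ is $$\liminf_{T\to\infty}\,-\frac1T\log p_{\mu,T}\in[0,\infty],\qquad -\log 0=\infty .$$ The uniform sampling algorithm pulls, for each budget $T$, the two arms equally often according to a schedule fixed in advance (the two numbers of pulls differ by at most one, so by exactly one if $T$ is odd), and recommends the arm with the larger empirical mean; the order of the pulls and the rule for breaking ties are arbitrary. Theorem. No algorithm is better than the uniform sampling algorithm: there is no algorithm whose error exponent is at least that of the uniform sampling algorithm on every instance $\mu$ and strictly larger on at least one instance. -/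

import Mathlib

open Filter Topology
open scoped ENNReal

noncomputable section

namespace TwoArmBandit

/-- The two arms. -/
abbrev Arm : Type := Fin 2

/-- A two-arm Bernoulli instance: the mean rewards lie in `(0, 1)` and are different, so that
there is a unique best arm. -/
structure Instance where
  mean : Arm → ℝ
  mean_pos : ∀ i, 0 < mean i
  mean_lt_one : ∀ i, mean i < 1
  mean_ne : mean 0 ≠ mean 1

/-- The Bernoulli reward law of arm `i` (`true` is the reward `1`, `false` the reward `0`). -/
def Instance.rewardLaw (μ : Instance) (i : Arm) : PMF Bool :=
  PMF.ofFintype (fun x => ENNReal.ofReal (if x = true then μ.mean i else 1 - μ.mean i)) (by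
    have h0 := (μ.mean_pos i).le
    have h1 : 0 ≤ 1 - μ.mean i := sub_nonneg.mpr (μ.mean_lt_one i).le
    rw [Fintype.sum_bool]
    simp only [if_true, Bool.false_eq_true, if_false]
    rw [← ENNReal.ofReal_add h0 h1, add_sub_cancel, ENNReal.ofReal_one])

/-- The arms pulled and the rewards observed so far, most recent round first. -/
abbrev History : Type := List (Arm × Bool)

/-- A fixed-budget algorithm. It knows the budget `T`. After a history `h` of fewer than `T` rounds
it draws the next arm from `sample T h`; after a history `h` of `T` rounds it recommends an arm
drawn from `recommend T h`. Deterministic rules are the point masses. -/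
structure Algorithm where
  sample : ℕ → History → PMF Arm
  recommend : ℕ → History → PMF Arm

/-- The law of the history of the first `t` rounds, when the algorithm `A` is run with budget `T`
on the instance `μ`. -/
def historyLaw (A : Algorithm) (μ : Instance) (T : ℕ) : ℕ → PMF History
  | 0 => PMF.pure []
  | t + 1 => (historyLaw A μ T t).bind fun h =>
      (A.sample T h).bind fun a =>
        (μ.rewardLaw a).bind fun x => PMF.pure ((a, x) :: h)

/-- The law of the recommended arm after the whole budget `T` has been used. -/
def recommendationLaw (A : Algorithm) (μ : Instance) (T : ℕ) : PMF Arm :=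
  (historyLaw A μ T T).bind fun h => A.recommend T h

/-- The probability that the recommended arm is not the best arm. -/
def errorProb (A : Algorithm) (μ : Instance) (T : ℕ) : ℝ≥0∞ :=
  (recommendationLaw A μ T).toOuterMeasure {i | ∃ j, μ.mean i < μ.mean j}

/-- The error exponent `liminf_{T → ∞} -(1/T) log P(error)`, an extended real number
(with `-log 0 = ∞`). -/
def errorExponent (A : Algorithm) (μ : Instance) : EReal :=
  liminf (fun T : ℕ => -ENNReal.log (errorProb A μ T) / (T : EReal)) atTop

/-- The number of pulls of arm `i`. -/
def pulls (h : History) (i : Arm) : ℕ :=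
  h.countP fun p => p.1 = i

/-- The number of pulls of arm `i` that gave the reward `1`. -/
def successes (h : History) (i : Arm) : ℕ :=
  h.countP fun p => p.1 = i ∧ p.2 = true

/-- The empirical mean of arm `i` (`0` if the arm has not been pulled). -/
def empiricalMean (h : History) (i : Arm) : ℝ :=
  (successes h i : ℝ) / (pulls h i : ℝ)

/-- `U` is the uniform sampling algorithm: for each budget `T` it follows a schedule fixed in
advance that pulls each arm equally often (up to one round when `T` is odd), and it recommends the
arm with the larger empirical mean. The order of the pulls and the rule by which ties are broken
are arbitrary. -/
structure IsUniformSampling (U : Algorithm) : Prop where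
  sample_eq : ∃ schedule : ℕ → ℕ → Arm,
    (∀ T, ∀ h : History, h.length < T → U.sample T h = PMF.pure (schedule T h.length)) ∧
    ∀ T, ∀ i j : Arm, ((Finset.range T).filter fun t => schedule T t = i).card ≤
      ((Finset.range T).filter fun t => schedule T t = j).card + 1
  recommend_eq : ∀ T, ∀ h : History, h.length = T →
    ∀ i j : Arm, empiricalMean h i < empiricalMean h j → U.recommend T h = PMF.pure j

/-- `A` is better than `U`: at least as good on every instance, strictly better on at least one. -/
def IsBetter (A U : Algorithm) : Prop :=
  (∀ μ : Instance, errorExponent U μ ≤ errorExponent A μ) ∧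
    ∃ μ : Instance, errorExponent U μ < errorExponent A μ

end TwoArmBandit

end

/-!
Uniform sampling attains at least the Chernoff exponent `chernoff x y` on the instance with natural
parameters (log-odds) `x` and `y`, by an exponential-moment bound that tilts both reward laws to the
midpoint parameter (`chernoff_le_errorExponent`). Conversely, an algorithm `A` whose exponent
dominates that of uniform sampling everywhere cannot exceed the Chernoff exponent anywhere.

The converse rests on a change of measure. On an instance `π` whose best arm is `b`, such an `A`
recommends `b` with probability tending to one. On an instance `μ` whose best arm is `a`,
recommending `b` is the error, and its probability is at least exponential in minus the information
that `A` collects under `π` for distinguishing `π` from `μ` (`recProb_transport`). Hence, if `ω` is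
a limit point of the expected proportion of pulls of `a` on `π`, the exponent on `μ` is at most the
`ω`-weighted average of the divergences from `π` to `μ` (`exists_proportion`). Letting `π` tend to
equal arms with natural parameter `θ` gives one `ω` with
`exponent of A on μ ≤ ω * bregman θ x + (1 - ω) * bregman θ y` for all `μ` with best arm `a`
(`exists_proportion_diagonal`).

Since the left-hand side is at least `chernoff x y` for all `x > y`, a second-order expansion around
`x = y = θ` forces `ω = 1 / 2` (`eq_half_of_chernoff_le`). With `θ` the midpoint of the parameters
of a given `μ`, the right-hand side is then exactly `chernoff x y`, so `A` is not strictly better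
on `μ`.

Expectations along a run are computed by iterating a one-round operator on functions of the history
(`step`), so that both probabilistic estimates are inductions on the number of remaining rounds.
-/

namespace TwoArmBandit

/-! ### Expectations along a run as iterates of a one-round operator -/

/-- The reward probabilities as real numbers. -/
noncomputable def Instance.rewardProb (μ : Instance) (i : Arm) (x : Bool) : ℝ :=
  if x = true then μ.mean i else 1 - μ.mean i

theorem Instance.rewardProb_pos (μ : Instance) (i : Arm) (x : Bool) : 0 < μ.rewardProb i x := by
  have h1 := μ.mean_pos i
  have h2 := μ.mean_lt_one i
  cases x <;> simp [rewardProb] <;> linarith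

theorem Instance.sum_rewardProb (μ : Instance) (i : Arm) : ∑ x, μ.rewardProb i x = 1 := by
  simp [rewardProb]

theorem Instance.toReal_rewardLaw (μ : Instance) (i : Arm) (x : Bool) :
    (μ.rewardLaw i x).toReal = μ.rewardProb i x := by
  have h := μ.rewardProb_pos i x
  unfold rewardProb at h
  simp [rewardLaw, rewardProb, ENNReal.toReal_ofReal h.le]

theorem sum_toReal_pmf {α : Type*} [Fintype α] (p : PMF α) : ∑ a, (p a).toReal = 1 := by
  have h : ∑ a, p a = 1 := by rw [← p.tsum_coe, tsum_fintype]
  rw [← ENNReal.toReal_sum fun a _ => p.apply_ne_top a, h, ENNReal.toReal_one]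

theorem toReal_pmf_bind {α β : Type*} [Fintype α] (p : PMF α) (f : α → PMF β) (b : β) :
    (p.bind f b).toReal = ∑ a, (p a).toReal * (f a b).toReal := by
  rw [PMF.bind_apply, tsum_fintype, ENNReal.toReal_sum fun a _ =>
    ENNReal.mul_ne_top (p.apply_ne_top a) ((f a).apply_ne_top b)]
  simp

/-- The one-round operator of `A` on the instance `μ`: `step A μ T f h` is the expectation of `f`
at the history that extends `h` by one round. Hence `(step A μ T)^[k] f h` is the expectation of
`f` after `k` more rounds. -/
noncomputable def step (A : Algorithm) (μ : Instance) (T : ℕ) (f : History → ℝ) (h : History) : ℝ :=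
  ∑ a, (A.sample T h a).toReal * ∑ x, μ.rewardProb a x * f ((a, x) :: h)

/-- Backward evaluation of a run: the law of a terminal recommendation rule `R` is obtained by
applying the one-round operator to the probabilities of `R`. -/
theorem historyLaw_bind (A : Algorithm) (μ : Instance) (T t : ℕ) (R : History → PMF Arm)
    (i : Arm) :
    ((historyLaw A μ T t).bind R i).toReal =
      (step A μ T)^[t] (fun h => (R h i).toReal) [] := by
  induction t generalizing R with
  | zero => simp [historyLaw]
  | succ t ih =>
    rw [historyLaw, PMF.bind_bind, ih, Function.iterate_succ_apply]
    refine congrArg (fun f => (step A μ T)^[t] f []) (funext fun h => ?_)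
    simp_rw [PMF.bind_bind, PMF.pure_bind, toReal_pmf_bind, Instance.toReal_rewardLaw, step]

theorem step_mono (A : Algorithm) (μ : Instance) (T : ℕ) : Monotone (step A μ T) := by
  intro f g hfg h
  unfold step
  gcongr with a _ x _
  · exact (μ.rewardProb_pos a x).le
  · exact hfg _

theorem step_linear (A : Algorithm) (μ : Instance) (T : ℕ) (c d : ℝ) (f g : History → ℝ) :
    step A μ T (fun h => c * f h + d * g h) =
      fun h => c * step A μ T f h + d * step A μ T g h := by
  funext h
  simp only [step, Finset.mul_sum, ← Finset.sum_add_distrib]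
  refine Finset.sum_congr rfl fun a _ => Finset.sum_congr rfl fun x _ => ?_
  ring

theorem iterate_step_linear (A : Algorithm) (μ : Instance) (T : ℕ) (c d : ℝ)
    (f g : History → ℝ) (k : ℕ) :
    (step A μ T)^[k] (fun h => c * f h + d * g h) =
      fun h => c * (step A μ T)^[k] f h + d * (step A μ T)^[k] g h := by
  induction k generalizing f g with
  | zero => rfl
  | succ k ih => rw [Function.iterate_succ_apply, step_linear, ih]; rfl

theorem step_const (A : Algorithm) (μ : Instance) (T : ℕ) (c : ℝ) :
    step A μ T (fun _ => c) = fun _ => c := by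
  funext h
  simp only [step, ← Finset.sum_mul, Instance.sum_rewardProb, sum_toReal_pmf, one_mul]

theorem iterate_step_const (A : Algorithm) (μ : Instance) (T : ℕ) (c : ℝ) (k : ℕ) :
    (step A μ T)^[k] (fun _ => c) = fun _ => c :=
  Function.iterate_fixed (step_const A μ T c) k

theorem step_pos (A : Algorithm) (μ : Instance) (T : ℕ) {f : History → ℝ} (hf : ∀ h, 0 < f h)
    (h : History) : 0 < step A μ T f h := by
  obtain ⟨a, -, ha⟩ : ∃ a ∈ Finset.univ, (0 : ℝ) < (A.sample T h a).toReal := by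
    refine Finset.exists_lt_of_sum_lt ?_
    rw [sum_toReal_pmf]
    simp
  have hx : ∀ a, 0 < ∑ x, μ.rewardProb a x * f ((a, x) :: h) := fun a =>
    Finset.sum_pos (fun x _ => mul_pos (μ.rewardProb_pos a x) (hf _)) Finset.univ_nonempty
  exact Finset.sum_pos' (fun a _ => mul_nonneg ENNReal.toReal_nonneg (hx a).le)
    ⟨a, Finset.mem_univ a, mul_pos ha (hx a)⟩

/-- The probability of recommending `i`, as a real number. -/
noncomputable def recProb (A : Algorithm) (μ : Instance) (T : ℕ) (i : Arm) : ℝ :=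
  (recommendationLaw A μ T i).toReal

theorem recProb_eq (A : Algorithm) (μ : Instance) (T : ℕ) (i : Arm) :
    recProb A μ T i = (step A μ T)^[T] (fun h => (A.recommend T h i).toReal) [] :=
  historyLaw_bind A μ T T _ i

theorem recProb_nonneg (A : Algorithm) (μ : Instance) (T : ℕ) (i : Arm) : 0 ≤ recProb A μ T i :=
  ENNReal.toReal_nonneg

theorem arm_univ {a b : Arm} (hab : a ≠ b) : (Finset.univ : Finset Arm) = {a, b} := by
  fin_cases a <;> fin_cases b <;> simp_all <;> decide

theorem sum_arm {M : Type*} [AddCommMonoid M] {a b : Arm} (hab : a ≠ b) (f : Arm → M) :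
    ∑ i, f i = f a + f b := by
  rw [arm_univ hab, Finset.sum_pair hab]

theorem recProb_add (A : Algorithm) (μ : Instance) (T : ℕ) {a b : Arm} (hab : a ≠ b) :
    recProb A μ T a + recProb A μ T b = 1 := by
  rw [← sum_arm hab]
  exact sum_toReal_pmf _

theorem errorProb_eq (A : Algorithm) (μ : Instance) (T : ℕ) {a b : Arm}
    (hμ : μ.mean b < μ.mean a) : errorProb A μ T = ENNReal.ofReal (recProb A μ T b) := by
  have hab : a ≠ b := fun h => hμ.ne (by rw [h])
  have hset : {i | ∃ j, μ.mean i < μ.mean j} = {b} := by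
    ext i
    have hi : i = a ∨ i = b := by
      have := Finset.mem_univ i
      rw [arm_univ hab] at this
      simpa using this
    simp only [Set.mem_ofPred_eq, Set.mem_singleton_iff]
    constructor
    · rintro ⟨j, hj⟩
      have hj' : j = a ∨ j = b := by
        have := Finset.mem_univ j
        rw [arm_univ hab] at this
        simpa using this
      rcases hi with rfl | rfl
      · rcases hj' with rfl | rfl
        · exact absurd hj (lt_irrefl _)
        · exact absurd hj hμ.not_gt
      · rfl
    · rintro rfl
      exact ⟨a, hμ⟩
  rw [errorProb, hset, PMF.toOuterMeasure_apply_singleton, recProb,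
    ENNReal.ofReal_toReal (PMF.apply_ne_top _ _)]

/-! ### Change of measure -/

/-- The Kullback–Leibler divergence between the reward laws of arm `i` on `π` and on `μ`. -/
noncomputable def Instance.kl (π μ : Instance) (i : Arm) : ℝ :=
  ∑ x, π.rewardProb i x * Real.log (π.rewardProb i x / μ.rewardProb i x)

/-- Jensen's inequality for `Real.log` under a finite law `w`. -/
theorem sum_mul_log_le {α : Type*} [Fintype α] {w p : α → ℝ} (hw : ∀ a, 0 ≤ w a)
    (hw1 : ∑ a, w a = 1) (hp : ∀ a, 0 < p a) :
    ∑ a, w a * Real.log (p a) ≤ Real.log (∑ a, w a * p a) := by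
  simpa using strictConcaveOn_log_Ioi.concaveOn.le_map_sum (t := Finset.univ) (w := w) (p := p)
    (fun a _ => hw a) hw1 (fun a _ => hp a)

/-- The Donsker–Varadhan inequality for a single reward. -/
theorem sum_rewardProb_mul_log_le (π μ : Instance) (i : Arm) {G : Bool → ℝ}
    (hG : ∀ x, 0 < G x) :
    ∑ x, π.rewardProb i x * Real.log (G x) - π.kl μ i ≤
      Real.log (∑ x, μ.rewardProb i x * G x) := by
  have h := sum_mul_log_le (w := π.rewardProb i)
    (p := fun x => μ.rewardProb i x / π.rewardProb i x * G x)
    (fun x => (π.rewardProb_pos i x).le) (π.sum_rewardProb i)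
    (fun x => mul_pos (div_pos (μ.rewardProb_pos i x) (π.rewardProb_pos i x)) (hG x))
  convert h using 2
  · rw [Instance.kl, ← Finset.sum_sub_distrib]
    refine Finset.sum_congr rfl fun x _ => ?_
    have h1 := (μ.rewardProb_pos i x).ne'
    have h2 := (π.rewardProb_pos i x).ne'
    rw [Real.log_mul (div_ne_zero h1 h2) (hG x).ne', Real.log_div h1 h2, Real.log_div h2 h1]
    ring
  · refine Finset.sum_congr rfl fun x _ => ?_
    have h2 := (π.rewardProb_pos i x).ne'
    field_simp

theorem pulls_cons (a i : Arm) (x : Bool) (h : History) :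
    (pulls ((a, x) :: h) i : ℝ) = pulls h i + if a = i then 1 else 0 := by
  simp only [pulls, List.countP_cons]
  split_ifs <;> simp_all

/-- The information accumulated along a history: each pull of arm `i` contributes the divergence
`kl π μ i`. -/
noncomputable def info (π μ : Instance) (h : History) : ℝ := ∑ i, pulls h i * π.kl μ i

theorem info_cons (π μ : Instance) (a : Arm) (x : Bool) (h : History) :
    info π μ ((a, x) :: h) = info π μ h + π.kl μ a := by
  simp [info, pulls_cons, add_mul, Finset.sum_add_distrib]

/-- One round of the Donsker–Varadhan inequality `log E_μ[e^φ] ≥ E_π[φ] - KL(π, μ)`. -/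
theorem step_log_sub_info_le (A : Algorithm) (π μ : Instance) (T : ℕ) {g : History → ℝ}
    (hg : ∀ h, 0 < g h) (h : History) :
    step A π T (fun h => Real.log (g h) - info π μ h) h ≤
      Real.log (step A μ T g h) - info π μ h := by
  have hpos : ∀ a, 0 < ∑ x, μ.rewardProb a x * g ((a, x) :: h) := fun a =>
    Finset.sum_pos (fun x _ => mul_pos (μ.rewardProb_pos a x) (hg _)) Finset.univ_nonempty
  have h1 := sum_mul_log_le (w := fun a => (A.sample T h a).toReal)
    (fun _ => ENNReal.toReal_nonneg) (sum_toReal_pmf _) hpos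
  have h2 : step A π T (fun h => Real.log (g h) - info π μ h) h + info π μ h ≤
      ∑ a, (A.sample T h a).toReal *
        Real.log (∑ x, μ.rewardProb a x * g ((a, x) :: h)) := by
    have hinfo : info π μ h = ∑ a, (A.sample T h a).toReal * info π μ h := by
      rw [← Finset.sum_mul, sum_toReal_pmf, one_mul]
    rw [hinfo, step, ← Finset.sum_add_distrib]
    refine Finset.sum_le_sum fun a _ => ?_
    rw [← mul_add]
    refine mul_le_mul_of_nonneg_left ?_ ENNReal.toReal_nonneg
    refine le_of_eq_of_le ?_ (sum_rewardProb_mul_log_le π μ a fun x => hg ((a, x) :: h))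
    have := π.sum_rewardProb a
    simp only [info_cons, mul_sub, mul_add, Finset.sum_sub_distrib, Finset.sum_add_distrib,
      ← Finset.sum_mul, this]
    ring
  have h3 : Real.log (step A μ T g h) = Real.log (∑ a, (A.sample T h a).toReal *
    (∑ x, μ.rewardProb a x * g ((a, x) :: h))) := rfl
  linarith

theorem iterate_step_log_sub_info_le (A : Algorithm) (π μ : Instance) (T k : ℕ)
    {g : History → ℝ} (hg : ∀ h, 0 < g h) :
    (step A π T)^[k] (fun h => Real.log (g h) - info π μ h) ≤
      fun h => Real.log ((step A μ T)^[k] g h) - info π μ h := by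
  induction k generalizing g with
  | zero => exact le_refl _
  | succ k ih =>
    rw [Function.iterate_succ_apply, Function.iterate_succ_apply]
    exact ((step_mono A π T).iterate k fun h => step_log_sub_info_le A π μ T hg h).trans
      (ih fun h => step_pos A μ T hg h)

/-- The expected number of pulls of arm `i` within the budget `T`. -/
noncomputable def meanPulls (A : Algorithm) (μ : Instance) (T : ℕ) (i : Arm) : ℝ :=
  (step A μ T)^[T] (fun h => (pulls h i : ℝ)) []

theorem meanPulls_nonneg (A : Algorithm) (μ : Instance) (T : ℕ) (i : Arm) :
    0 ≤ meanPulls A μ T i := by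
  have h := (step_mono A μ T).iterate T
    (show (fun _ => (0 : ℝ)) ≤ fun h : History => (pulls h i : ℝ) from fun h => Nat.cast_nonneg _)
  rw [iterate_step_const] at h
  exact h []

theorem pulls_add_pulls {a b : Arm} (hab : a ≠ b) (h : History) :
    (pulls h a : ℝ) + pulls h b = h.length := by
  induction h with
  | nil => simp [pulls]
  | cons p h ih =>
    obtain ⟨i, x⟩ := p
    have hi : (if i = a then (1 : ℝ) else 0) + (if i = b then 1 else 0) = 1 := by
      have := sum_arm hab fun j => if i = j then (1 : ℝ) else 0
      rw [← this]
      simp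
    rw [pulls_cons, pulls_cons, List.length_cons]
    push_cast
    linarith

theorem iterate_step_length (A : Algorithm) (μ : Instance) (T k : ℕ) (h : History) :
    (step A μ T)^[k] (fun h => (h.length : ℝ)) h = h.length + k := by
  induction k generalizing h with
  | zero => simp
  | succ k ih =>
    rw [Function.iterate_succ_apply']
    simp only [step, ih, List.length_cons, ← Finset.sum_mul, Instance.sum_rewardProb,
      sum_toReal_pmf]
    push_cast
    ring

theorem meanPulls_add (A : Algorithm) (μ : Instance) (T : ℕ) {a b : Arm} (hab : a ≠ b) :
    meanPulls A μ T a + meanPulls A μ T b = T := by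
  have h := iterate_step_length A μ T T []
  have h2 := congrFun (iterate_step_linear A μ T 1 1 (fun h => (pulls h a : ℝ))
    (fun h => (pulls h b : ℝ)) T) []
  simp only [one_mul, pulls_add_pulls hab] at h2
  rw [h] at h2
  simpa [meanPulls] using h2.symm

/-- The transportation inequality: if `b` is recommended with positive probability on `π`, then on
`μ` its probability is at least `exp (-(K + log 2) / p)`, where `p` is the probability on `π` and
`K` the expected information under `π`. -/
theorem recProb_transport (A : Algorithm) (π μ : Instance) (T : ℕ) {a b : Arm} (hab : a ≠ b)
    (hp : 0 < recProb A π T b) :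
    0 < recProb A μ T b ∧
      recProb A π T b * -Real.log (recProb A μ T b) ≤
        meanPulls A π T a * π.kl μ a + meanPulls A π T b * π.kl μ b + Real.log 2 := by
  set p := recProb A π T b with hpdef
  set q := recProb A μ T b with hqdef
  set K := meanPulls A π T a * π.kl μ a + meanPulls A π T b * π.kl μ b with hK
  -- the value of `s` for which the lower bound `exp (s * p - K)` on `q * (exp s - 1) + 1` is `2`
  set s := (K + Real.log 2) / p with hs
  have hsp : s * p = K + Real.log 2 := div_mul_cancel₀ _ hp.ne'
  set r : History → ℝ := fun h => (A.recommend T h b).toReal with hr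
  have hr0 : ∀ h, 0 ≤ r h := fun h => ENNReal.toReal_nonneg
  have hr1 : ∀ h, r h ≤ 1 := fun h =>
    ENNReal.toReal_le_of_le_ofReal zero_le_one (by simpa using PMF.coe_le_one _ _)
  -- `g h` is the mean of `exp (s * X)` for `X` Bernoulli with mean `r h`; the product `1 * 1` fits
  -- the form of `iterate_step_linear`
  set g : History → ℝ := fun h => (Real.exp s - 1) * r h + 1 * 1 with hg
  have hgexp : ∀ h, Real.exp (s * r h) ≤ g h := by
    intro h
    have := convexOn_exp.2 (Set.mem_univ s) (Set.mem_univ 0) (hr0 h)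
      (sub_nonneg.2 (hr1 h)) (by ring)
    simp only [smul_eq_mul, mul_zero, add_zero, Real.exp_zero, mul_one] at this
    rw [mul_comm s]
    refine this.trans (le_of_eq ?_)
    simp only [hg]
    ring
  have hgpos : ∀ h, 0 < g h := fun h => (Real.exp_pos _).trans_le (hgexp h)
  have h1 := iterate_step_log_sub_info_le A π μ T T hgpos []
  have h2 : (step A π T)^[T] (fun h => s * r h + (-1) * info π μ h) [] ≤
      (step A π T)^[T] (fun h => Real.log (g h) - info π μ h) [] := by
    refine (step_mono A π T).iterate T (fun h => ?_) []
    have := (Real.le_log_iff_exp_le (hgpos h)).2 (hgexp h)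
    simp only
    linarith
  have hinfo : info π μ =
      fun h => π.kl μ a * (pulls h a : ℝ) + π.kl μ b * (pulls h b : ℝ) := by
    funext h
    rw [info, sum_arm hab]
    ring
  replace h2 := h2.trans h1
  rw [iterate_step_linear, show (step A π T)^[T] (info π μ) = _ from by
    rw [hinfo, iterate_step_linear]] at h2
  have h3 : (step A μ T)^[T] g [] = (Real.exp s - 1) * q + 1 := by
    rw [hg, iterate_step_linear, iterate_step_const, hqdef, recProb_eq]
    simp only [mul_one, hr]
  have h4 : s * p - K ≤ Real.log ((Real.exp s - 1) * q + 1) := by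
    have e1 : (step A π T)^[T] r [] = p := (recProb_eq A π T b).symm
    have e2 : (step A π T)^[T] (fun h => (pulls h a : ℝ)) [] = meanPulls A π T a := rfl
    have e3 : (step A π T)^[T] (fun h => (pulls h b : ℝ)) [] = meanPulls A π T b := rfl
    have e4 : info π μ [] = 0 := by simp [info, pulls]
    simp only [e1, e2, e3, h3, e4, sub_zero] at h2
    linarith
  have hq0 : 0 ≤ q := recProb_nonneg A μ T b
  have hgT : 0 < (Real.exp s - 1) * q + 1 := by
    rw [← h3]
    have : ∀ k h, 0 < (step A μ T)^[k] g h := by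
      intro k
      induction k with
      | zero => exact hgpos
      | succ k ih =>
        rw [Function.iterate_succ_apply']
        exact step_pos A μ T ih
    exact this T []
  have h5 : 1 ≤ Real.exp s * q := by
    rw [hsp, add_sub_cancel_left, Real.log_le_log_iff two_pos hgT] at h4
    linarith
  have hq : 0 < q := hq0.lt_of_ne fun h => by rw [← h] at h5; norm_num at h5
  refine ⟨hq, ?_⟩
  have h6 := Real.log_le_log one_pos h5
  rw [Real.log_one, Real.log_mul (Real.exp_pos s).ne' hq.ne', Real.log_exp] at h6
  nlinarith

/-! ### Bernoulli laws in the natural parameter -/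

/-- The log-partition function of the Bernoulli family in its natural parameter. -/
noncomputable def logPartition (θ : ℝ) : ℝ := Real.log (1 + Real.exp θ)

/-- The Bregman divergence of `logPartition`, which is the Kullback–Leibler divergence between the
Bernoulli laws with natural parameters `θ` and `η` (see `Instance.kl_eq`). -/
noncomputable def bregman (θ η : ℝ) : ℝ :=
  logPartition η - logPartition θ - (η - θ) * Real.sigmoid θ

theorem one_sub_sigmoid_eq_exp (θ : ℝ) : 1 - Real.sigmoid θ = Real.exp (-logPartition θ) := by
  rw [← Real.sigmoid_neg, Real.sigmoid_def, neg_neg, logPartition, Real.exp_neg,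
    Real.exp_log (by positivity)]

theorem sigmoid_eq_exp (θ : ℝ) : Real.sigmoid θ = Real.exp (θ - logPartition θ) := by
  rw [sub_eq_add_neg, Real.exp_add, ← one_sub_sigmoid_eq_exp, ← Real.sigmoid_neg,
    ← Real.sigmoid_mul_rexp_neg, mul_left_comm, ← Real.exp_add]
  simp

theorem exp_logPartition (θ : ℝ) : Real.exp (logPartition θ) = 1 + Real.exp θ :=
  Real.exp_log (by positivity)

theorem hasDerivAt_logPartition (θ : ℝ) : HasDerivAt logPartition (Real.sigmoid θ) θ := by
  have h : HasDerivAt logPartition (Real.exp θ / (1 + Real.exp θ)) θ :=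
    ((Real.hasDerivAt_exp θ).const_add 1).log (by positivity)
  rwa [sigmoid_eq_exp, Real.exp_sub, exp_logPartition]

theorem continuous_logPartition : Continuous logPartition :=
  continuous_iff_continuousAt.2 fun θ => (hasDerivAt_logPartition θ).continuousAt

theorem strictConvexOn_logPartition : StrictConvexOn ℝ Set.univ logPartition := by
  refine StrictMono.strictConvexOn_univ_of_deriv continuous_logPartition ?_
  rw [show deriv logPartition = Real.sigmoid from
    funext fun θ => (hasDerivAt_logPartition θ).deriv]
  exact Real.sigmoid_strictMono

/-- The natural parameter (log-odds) of arm `i`. -/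
noncomputable def Instance.param (μ : Instance) (i : Arm) : ℝ :=
  -Real.log ((μ.mean i)⁻¹ - 1)

theorem Instance.mean_eq (μ : Instance) (i : Arm) : μ.mean i = Real.sigmoid (μ.param i) := by
  have h : 0 < (μ.mean i)⁻¹ - 1 :=
    sub_pos.2 ((one_lt_inv₀ (μ.mean_pos i)).2 (μ.mean_lt_one i))
  rw [param, Real.sigmoid_def, neg_neg, Real.exp_log h, add_sub_cancel, inv_inv]

theorem Instance.mean_lt_mean_iff (μ : Instance) {i j : Arm} :
    μ.mean i < μ.mean j ↔ μ.param i < μ.param j := by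
  rw [mean_eq, mean_eq, Real.sigmoid_lt_iff]

theorem exists_param {a b : Arm} (hab : a ≠ b) {x y : ℝ} (hxy : x ≠ y) :
    ∃ μ : Instance, μ.param a = x ∧ μ.param b = y := by
  have hinj : Function.Injective fun i : Arm => if i = a then x else y := by
    intro i j hij
    have : ∀ i : Arm, i = a ∨ i = b := fun i => by
      simpa [arm_univ hab] using Finset.mem_univ i
    rcases this i with hi | hi <;> rcases this j with hj | hj
    · rw [hi, hj]
    · simp [hi, hj, hab.symm, hxy] at hij
    · simp [hi, hj, hab.symm, hxy.symm] at hij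
    · rw [hi, hj]
  let μ : Instance :=
    { mean := fun i => Real.sigmoid (if i = a then x else y)
      mean_pos := fun i => Real.sigmoid_pos _
      mean_lt_one := fun i => Real.sigmoid_lt_one _
      mean_ne := fun h => absurd (hinj (Real.sigmoid_injective h)) (by decide) }
  refine ⟨μ, Real.sigmoid_injective ?_, Real.sigmoid_injective ?_⟩
  · rw [← μ.mean_eq]
    simp [μ]
  · rw [← μ.mean_eq]
    simp [μ, hab.symm]

theorem Instance.rewardProb_true (μ : Instance) (i : Arm) :
    μ.rewardProb i true = Real.exp (μ.param i - logPartition (μ.param i)) := by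
  rw [rewardProb, if_pos rfl, mean_eq, sigmoid_eq_exp]

theorem Instance.rewardProb_false (μ : Instance) (i : Arm) :
    μ.rewardProb i false = Real.exp (-logPartition (μ.param i)) := by
  rw [rewardProb, if_neg (by simp), mean_eq, one_sub_sigmoid_eq_exp]

theorem Instance.kl_eq (π μ : Instance) (i : Arm) :
    π.kl μ i = bregman (π.param i) (μ.param i) := by
  rw [kl, Fintype.sum_bool]
  simp only [rewardProb_true, rewardProb_false, ← Real.exp_sub, Real.log_exp]
  rw [← sigmoid_eq_exp, ← one_sub_sigmoid_eq_exp, bregman]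
  ring

/-- The moment generating function of a Bernoulli law. -/
theorem sum_rewardProb_mul_exp (μ : Instance) (i : Arm) (u : ℝ) :
    ∑ x, μ.rewardProb i x * Real.exp (if x = true then u else 0) =
      Real.exp (logPartition (μ.param i + u) - logPartition (μ.param i)) := by
  rw [Fintype.sum_bool, μ.rewardProb_true, μ.rewardProb_false, Real.exp_sub (logPartition _),
    exp_logPartition]
  simp only [if_true, Bool.false_eq_true, if_false, Real.exp_zero, mul_one]
  rw [← Real.exp_add, div_eq_mul_inv, ← Real.exp_neg, add_mul, one_mul, ← Real.exp_add, add_comm]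
  congr 2
  ring

/-! ### The error exponent of uniform sampling -/

/-- The Chernoff exponent: the Jensen gap of `logPartition` at the midpoint, for natural
parameters `x` and `y` of the two arms. It is the minimum over `η` of
`(bregman η x + bregman η y) / 2`, attained at the midpoint. -/
noncomputable def chernoff (x y : ℝ) : ℝ :=
  (logPartition x + logPartition y) / 2 - logPartition ((x + y) / 2)

theorem chernoff_pos {x y : ℝ} (hxy : x ≠ y) : 0 < chernoff x y := by
  have h := strictConvexOn_logPartition.right (Set.mem_univ x) (Set.mem_univ y) hxy
    one_half_pos one_half_pos (add_halves 1)
  simp only [smul_eq_mul] at h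
  rw [chernoff, show (x + y) / 2 = 1 / 2 * x + 1 / 2 * y by ring]
  linarith

theorem chernoff_eq_bregman (x y : ℝ) :
    chernoff x y = (bregman ((x + y) / 2) x + bregman ((x + y) / 2) y) / 2 := by
  simp only [chernoff, bregman]
  ring

theorem successes_cons (a i : Arm) (x : Bool) (h : History) :
    (successes ((a, x) :: h) i : ℝ) =
      successes h i + if a = i then (if x = true then 1 else 0) else 0 := by
  simp only [successes, List.countP_cons]
  split_ifs <;> simp_all

theorem successes_le_pulls (h : History) (i : Arm) : successes h i ≤ pulls h i := by
  unfold successes pulls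
  refine List.countP_mono_left fun p _ hp => ?_
  simp only [decide_eq_true_eq] at hp ⊢
  exact hp.1

/-- With numbers of pulls that differ by at most one, a recommendation of `b` that does not
contradict the empirical means forces arm `a` to have at most one success more than arm `b`. -/
theorem successes_le_add_one {h : History} {a b : Arm} (hpulls : pulls h a ≤ pulls h b + 1)
    (hmean : empiricalMean h a ≤ empiricalMean h b) : successes h a ≤ successes h b + 1 := by
  have ha := successes_le_pulls h a
  have hb := successes_le_pulls h b
  rcases Nat.eq_zero_or_pos (pulls h a) with h0 | ha0
  · omega
  rcases Nat.eq_zero_or_pos (pulls h b) with h0 | hb0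
  · omega
  have key : successes h a * pulls h b ≤ successes h b * pulls h a := by
    unfold empiricalMean at hmean
    rw [div_le_div_iff₀ (by exact_mod_cast ha0) (by exact_mod_cast hb0)] at hmean
    exact_mod_cast hmean
  nlinarith

/-- The error probability of uniform sampling decays at least at the Chernoff rate. On an error the
successes satisfy `successes h a ≤ successes h b + 1`, so the error indicator is at most
`exp t * exp (t * (successes h b - successes h a))`; the expectation of this factorizes along the
deterministic schedule. -/
theorem recProb_uniform_le {U : Algorithm} (hU : IsUniformSampling U) (μ : Instance)
    {a b : Arm} (hμ : μ.mean b < μ.mean a) :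
    ∃ C : ℝ, 0 < C ∧ ∀ T : ℕ,
      recProb U μ T b ≤ C * Real.exp (-(chernoff (μ.param a) (μ.param b) * T)) := by
  obtain ⟨⟨sched, hs, hbal⟩, hrec⟩ := hU
  have hab : a ≠ b := fun h => hμ.ne (by rw [h])
  have hparam := μ.mean_lt_mean_iff.1 hμ
  -- the tilt that moves both natural parameters to their midpoint
  set t := (μ.param a - μ.param b) / 2 with ht
  have ht0 : 0 < t := by rw [ht]; linarith
  set m := (μ.param a + μ.param b) / 2 with hm
  set c : Arm → ℝ := fun i => logPartition m - logPartition (μ.param i) with hc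
  set Z : History → ℝ := fun h => Real.exp (t * ((successes h b : ℝ) - successes h a)) with hZ
  have hZstep : ∀ (i : Arm) (h : History),
      ∑ x, μ.rewardProb i x * Z ((i, x) :: h) = Z h * Real.exp (c i) := by
    intro i h
    obtain ⟨u, hu, hiu⟩ : ∃ u : ℝ, μ.param i + u = m ∧ ∀ x : Bool,
        Z ((i, x) :: h) = Z h * Real.exp (if x = true then u else 0) := by
      have hi : i = a ∨ i = b := by
        have := Finset.mem_univ i
        rw [arm_univ hab] at this
        simpa using this
      rcases hi with rfl | rfl
      · refine ⟨-t, by rw [ht, hm]; ring, fun x => ?_⟩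
        simp only [hZ, successes_cons, ← Real.exp_add, if_neg hab, if_true]
        congr 1
        split_ifs <;> ring
      · refine ⟨t, by rw [ht, hm]; ring, fun x => ?_⟩
        simp only [hZ, successes_cons, ← Real.exp_add, if_neg hab.symm, if_true]
        congr 1
        split_ifs <;> ring
    have := sum_rewardProb_mul_exp μ i u
    rw [hu] at this
    rw [show Real.exp (c i) = _ from this.symm, Finset.mul_sum]
    refine Finset.sum_congr rfl fun x _ => ?_
    rw [hiu]
    ring
  set n : ℕ → Arm → ℕ := fun T i => ((Finset.range T).filter fun j => sched T j = i).card with hn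
  -- backward induction along histories that follow the schedule
  have main : ∀ T k : ℕ, ∀ h : History, h.length + k = T →
      (∀ i, pulls h i = ((Finset.range h.length).filter fun j => sched T j = i).card) →
      (step U μ T)^[k] (fun h => (U.recommend T h b).toReal) h ≤
        Real.exp t * Z h * Real.exp (∑ j ∈ Finset.Ico h.length T, c (sched T j)) := by
    intro T k
    induction k with
    | zero =>
      intro h hlen hp
      have hlen : h.length = T := hlen
      rw [hlen] at hp
      rw [Function.iterate_zero_apply, hlen, Finset.Ico_self, Finset.sum_empty, Real.exp_zero,
        mul_one]
      rcases lt_or_ge (empiricalMean h b) (empiricalMean h a) with hlt | hle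
      · rw [hrec T h hlen b a hlt]
        simp only [PMF.pure_apply, if_neg hab.symm, ENNReal.toReal_zero]
        positivity
      · have h1 : (U.recommend T h b).toReal ≤ 1 :=
          ENNReal.toReal_le_of_le_ofReal zero_le_one (by simpa using PMF.coe_le_one _ _)
        have h2 : (successes h a : ℝ) ≤ successes h b + 1 := by
          exact_mod_cast successes_le_add_one (by rw [hp, hp]; exact hbal T a b) hle
        refine h1.trans ?_
        rw [← Real.exp_add]
        refine Real.one_le_exp ?_
        nlinarith
    | succ k ih =>
      intro h hlen hp
      have hlt : h.length < T := by omega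
      rw [Function.iterate_succ_apply', step, hs T h hlt]
      set i := sched T h.length with hi
      rw [Finset.sum_eq_single i (fun j _ hj => by simp [PMF.pure_apply, hj]) (by simp)]
      simp only [PMF.pure_apply, if_true, ENNReal.toReal_one, one_mul]
      have hle : ∀ x : Bool, (step U μ T)^[k] (fun h => (U.recommend T h b).toReal) ((i, x) :: h) ≤
          Real.exp t * Z ((i, x) :: h) *
            Real.exp (∑ j ∈ Finset.Ico (h.length + 1) T, c (sched T j)) := by
        intro x
        refine ih ((i, x) :: h) (by rw [List.length_cons]; omega) fun j => ?_
        have hpj := pulls_cons i j x h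
        rw [List.length_cons, Finset.range_add_one, Finset.filter_insert]
        by_cases hij : i = j
        · rw [if_pos hij] at hpj
          rw [if_pos (hi ▸ hij), Finset.card_insert_of_notMem (by simp), ← hp j]
          exact_mod_cast hpj
        · rw [if_neg hij, add_zero] at hpj
          rw [if_neg (hi ▸ hij), ← hp j]
          exact_mod_cast hpj
      calc _ ≤ ∑ x, μ.rewardProb i x * (Real.exp t * Z ((i, x) :: h) *
            Real.exp (∑ j ∈ Finset.Ico (h.length + 1) T, c (sched T j))) :=
            Finset.sum_le_sum fun x _ =>
              mul_le_mul_of_nonneg_left (hle x) (μ.rewardProb_pos i x).le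
        _ = Real.exp t * (∑ x, μ.rewardProb i x * Z ((i, x) :: h)) *
            Real.exp (∑ j ∈ Finset.Ico (h.length + 1) T, c (sched T j)) := by
            rw [Finset.mul_sum, Finset.sum_mul]
            exact Finset.sum_congr rfl fun x _ => by ring
        _ = _ := by
            rw [hZstep, Finset.sum_eq_sum_Ico_succ_bot hlt, Real.exp_add]
            ring
  refine ⟨Real.exp (t + |c a - c b| / 2), Real.exp_pos _, fun T => ?_⟩
  rw [recProb_eq]
  refine (main T T [] (by simp) (by simp [pulls])).trans ?_
  have hsum : ∑ j ∈ Finset.Ico 0 T, c (sched T j) = n T a * c a + n T b * c b := by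
    rw [← Finset.range_eq_Ico, ← Finset.sum_fiberwise (Finset.range T) (sched T), sum_arm hab]
    congr 1 <;>
    · rw [Finset.sum_congr rfl fun j hj => by rw [(Finset.mem_filter.1 hj).2], Finset.sum_const,
        nsmul_eq_mul]
  have hT : (n T a : ℝ) + n T b = T := by
    have := Finset.card_eq_sum_card_fiberwise (s := Finset.range T) (t := Finset.univ)
      (f := sched T) (fun _ _ => by simp)
    rw [sum_arm hab, Finset.card_range] at this
    exact_mod_cast this.symm
  have h1 : (n T a : ℝ) ≤ n T b + 1 := by exact_mod_cast hbal T a b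
  have h2 : (n T b : ℝ) ≤ n T a + 1 := by exact_mod_cast hbal T b a
  have h3 : ((n T a : ℝ) - n T b) * (c a - c b) ≤ |c a - c b| := by
    refine (le_abs_self _).trans ?_
    rw [abs_mul]
    exact mul_le_of_le_one_left (abs_nonneg _) (abs_le.2 ⟨by linarith, by linarith⟩)
  have h4 : c a + c b = -2 * chernoff (μ.param a) (μ.param b) := by
    simp only [hc, chernoff, ← hm]
    ring
  rw [List.length_nil, hsum, hZ, ← Real.exp_add, ← Real.exp_add]
  simp only [successes, List.countP_nil, Nat.cast_zero, sub_zero, mul_zero, add_zero]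
  rw [← Real.exp_add, Real.exp_le_exp, ← hT]
  nlinarith

/-! ### Error exponents as exponential decay rates -/

theorem le_neg_log_div_iff {c q : ℝ} {T : ℕ} (hT : 0 < T) :
    (c : EReal) ≤ -ENNReal.log (ENNReal.ofReal q) / (T : EReal) ↔
      q ≤ Real.exp (-(c * T)) := by
  have hT' : (0 : EReal) < (T : EReal) := by exact_mod_cast hT
  rw [EReal.le_div_iff_mul_le hT' (EReal.natCast_ne_top T), EReal.le_neg,
    ← EReal.coe_coe_eq_natCast, ← EReal.coe_mul, ← EReal.coe_neg,
    ← Real.log_exp (-(c * T)), ← ENNReal.log_ofReal_of_pos (Real.exp_pos _),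
    ENNReal.log_le_log_iff, ENNReal.ofReal_le_ofReal_iff (Real.exp_pos _).le, Real.log_exp]

theorem eventually_recProb_le (A : Algorithm) (μ : Instance) {a b : Arm}
    (hμ : μ.mean b < μ.mean a) {c : ℝ} (hc : (c : EReal) < errorExponent A μ) :
    ∀ᶠ T : ℕ in atTop, recProb A μ T b ≤ Real.exp (-(c * T)) := by
  filter_upwards [eventually_lt_of_lt_liminf hc, eventually_gt_atTop 0] with T h hT
  rw [errorProb_eq A μ T hμ] at h
  exact (le_neg_log_div_iff hT).1 h.le

/-- The multiplicative constant `C` does not affect the exponent. -/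
theorem le_errorExponent {A : Algorithm} {μ : Instance} {a b : Arm}
    (hμ : μ.mean b < μ.mean a) {g C : ℝ} (hC : 0 < C)
    (h : ∀ T : ℕ, recProb A μ T b ≤ C * Real.exp (-(g * T))) :
    (g : EReal) ≤ errorExponent A μ := by
  refine EReal.ge_of_forall_gt_iff_ge.1 fun c hc => le_liminf_of_le (h := ?_)
  have hcg : 0 < g - c := sub_pos.2 (EReal.coe_lt_coe_iff.1 hc)
  have hlim : Tendsto (fun T : ℕ => (g - c) * (T : ℝ)) atTop atTop :=
    tendsto_natCast_atTop_atTop.const_mul_atTop hcg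
  filter_upwards [hlim.eventually_ge_atTop (Real.log C), eventually_gt_atTop 0] with T h1 hT
  rw [errorProb_eq A μ T hμ, le_neg_log_div_iff hT]
  refine (h T).trans ?_
  rw [← Real.exp_log hC, ← Real.exp_add, Real.exp_le_exp]
  linarith

theorem chernoff_le_errorExponent {U : Algorithm} (hU : IsUniformSampling U) (μ : Instance)
    {a b : Arm} (hμ : μ.mean b < μ.mean a) :
    (chernoff (μ.param a) (μ.param b) : EReal) ≤ errorExponent U μ := by
  obtain ⟨C, hC, h⟩ := recProb_uniform_le hU μ hμ
  exact le_errorExponent hμ hC h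

/-! ### Limiting sampling proportions -/

theorem tendsto_recProb_best (A : Algorithm) (π : Instance) {a b : Arm}
    (hπ : π.mean a < π.mean b) (hpos : 0 < errorExponent A π) :
    Tendsto (fun T => recProb A π T b) atTop (𝓝 1) := by
  have hab : a ≠ b := fun h => hπ.ne (by rw [h])
  obtain ⟨c, hc0, hc⟩ := EReal.lt_iff_exists_real_btwn.1 hpos
  have hc0 : 0 < c := by exact_mod_cast hc0
  have h0 : Tendsto (fun T => recProb A π T a) atTop (𝓝 0) := by
    refine squeeze_zero' (Eventually.of_forall fun T => recProb_nonneg A π T a)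
      (eventually_recProb_le A π hπ hc) ?_
    exact Real.tendsto_exp_neg_atTop_nhds_zero.comp
      (tendsto_natCast_atTop_atTop.const_mul_atTop hc0)
  have h1 : (fun T => recProb A π T b) = fun T => 1 - recProb A π T a :=
    funext fun T => by rw [← recProb_add A π T hab]; ring
  rw [h1]
  simpa using h0.const_sub 1

/-- If `A` detects the best arm `b` of `π`, then some limit point `ω` of its sampling proportion of
arm `a` on `π` bounds the exponent on every instance whose best arm is `a`. The same `ω` serves all
those instances because the limit is taken along one ultrafilter. -/
theorem exists_proportion (A : Algorithm) (π : Instance) {a b : Arm}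
    (hπ : π.mean a < π.mean b) (hpos : 0 < errorExponent A π) :
    ∃ ω ∈ Set.Icc (0 : ℝ) 1, ∀ μ : Instance, μ.mean b < μ.mean a → ∀ c : ℝ,
      (c : EReal) < errorExponent A μ →
        c ≤ ω * bregman (π.param a) (μ.param a) + (1 - ω) * bregman (π.param b) (μ.param b) := by
  have hab : a ≠ b := fun h => hπ.ne (by rw [h])
  set 𝒰 : Ultrafilter ℕ := Ultrafilter.of atTop
  have h𝒰 : (𝒰 : Filter ℕ) ≤ atTop := Ultrafilter.of_le atTop
  set w : ℕ → ℝ := fun T => meanPulls A π T a / T with hw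
  have hmem : ∀ T, w T ∈ Set.Icc (0 : ℝ) 1 := fun T => by
    have h1 := meanPulls_nonneg A π T a
    have h2 := meanPulls_nonneg A π T b
    have h3 := meanPulls_add A π T hab
    exact ⟨div_nonneg h1 (Nat.cast_nonneg T), div_le_one_of_le₀ (by linarith) (Nat.cast_nonneg T)⟩
  obtain ⟨ω, hω, hlim⟩ := isCompact_Icc.ultrafilter_le_nhds (𝒰.map w)
    (le_principal_iff.2 (Eventually.of_forall hmem : ∀ᶠ T in (𝒰 : Filter ℕ), w T ∈ Set.Icc 0 1))
  have hlim : Tendsto w 𝒰 (𝓝 ω) := hlim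
  refine ⟨ω, hω, fun μ hμ c hc => ?_⟩
  have hp := tendsto_recProb_best A π hπ hpos
  have hleft : Tendsto (fun T : ℕ => recProb A π T b * c - Real.log 2 / T) 𝒰 (𝓝 c) := by
    have := (hp.mul_const c).sub (tendsto_const_div_atTop_nhds_zero_nat (Real.log 2))
    simpa using this.mono_left h𝒰
  have hright := (hlim.mul_const (π.kl μ a)).add ((hlim.const_sub 1).mul_const (π.kl μ b))
  rw [← Instance.kl_eq, ← Instance.kl_eq]
  refine le_of_tendsto_of_tendsto hleft hright (h𝒰 ?_)
  filter_upwards [hp.eventually (lt_mem_nhds one_pos), eventually_gt_atTop 0,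
    eventually_recProb_le A μ hμ hc] with T hpT hT hqT
  obtain ⟨hq, htr⟩ := recProb_transport A π μ T hab hpT
  have hT' : (0 : ℝ) < T := Nat.cast_pos.2 hT
  have h1 : c * T ≤ -Real.log (recProb A μ T b) := by
    have := Real.log_le_log hq hqT
    rw [Real.log_exp] at this
    linarith
  have h2 := (mul_le_mul_of_nonneg_left h1 hpT.le).trans htr
  have hb : meanPulls A π T b = T - meanPulls A π T a := by
    rw [← meanPulls_add A π T hab]
    ring
  rw [hb] at h2
  refine le_of_mul_le_mul_right ?_ hT'
  have e1 : (recProb A π T b * c - Real.log 2 / T) * T = recProb A π T b * (c * T) - Real.log 2 := by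
    field_simp
  have e2 : (w T * π.kl μ a + (1 - w T) * π.kl μ b) * T =
      meanPulls A π T a * π.kl μ a + (T - meanPulls A π T a) * π.kl μ b := by
    simp only [hw]
    field_simp
  show _ * (T : ℝ) ≤ (w T * π.kl μ a + (1 - w T) * π.kl μ b) * T
  rw [e1, e2]
  linarith

/-- The limit of `exists_proportion` as `π` tends to the instance, not itself admissible, in which
both arms have natural parameter `θ`. -/
theorem exists_proportion_diagonal (A : Algorithm) (hpos : ∀ π, 0 < errorExponent A π)
    {a b : Arm} (hab : a ≠ b) (θ : ℝ) :
    ∃ ω ∈ Set.Icc (0 : ℝ) 1, ∀ μ : Instance, μ.mean b < μ.mean a → ∀ c : ℝ,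
      (c : EReal) < errorExponent A μ →
        c ≤ ω * bregman θ (μ.param a) + (1 - ω) * bregman θ (μ.param b) := by
  have hex : ∀ n : ℕ, ∃ ω ∈ Set.Icc (0 : ℝ) 1, ∀ μ : Instance, μ.mean b < μ.mean a → ∀ c : ℝ,
      (c : EReal) < errorExponent A μ →
        c ≤ ω * bregman θ (μ.param a) +
          (1 - ω) * bregman (θ + 1 / ((n : ℝ) + 1)) (μ.param b) := by
    intro n
    have hn : (0 : ℝ) < 1 / ((n : ℝ) + 1) := Nat.one_div_pos_of_nat
    obtain ⟨π, ha, hb⟩ := exists_param hab (x := θ) (y := θ + 1 / ((n : ℝ) + 1)) (by linarith)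
    have := exists_proportion A π (a := a) (b := b)
      (π.mean_lt_mean_iff.2 (by rw [ha, hb]; linarith)) (hpos π)
    rwa [ha, hb] at this
  choose w hmem hw using hex
  obtain ⟨ω, hω, φ, hφ, hlim⟩ := isCompact_Icc.tendsto_subseq hmem
  refine ⟨ω, hω, fun μ hμ c hc => ?_⟩
  have hθ : Tendsto (fun n : ℕ => θ + 1 / ((n : ℝ) + 1)) atTop (𝓝 θ) := by
    simpa using (tendsto_one_div_add_atTop_nhds_zero_nat (𝕜 := ℝ)).const_add θ
  have hcont : Continuous fun η => bregman η (μ.param b) := by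
    unfold bregman
    have := continuous_logPartition
    have := continuous_sigmoid
    fun_prop
  have hd := ((hcont.tendsto θ).comp hθ).comp hφ.tendsto_atTop
  refine ge_of_tendsto' ((hlim.mul_const (bregman θ (μ.param a))).add
    ((hlim.const_sub 1).mul hd)) fun n => hw (φ n) μ hμ c hc

/-! ### The limiting proportion near equal arms is one half -/

/-- Second-order expansion of `bregman θ` at `θ`, by L'Hôpital's rule. -/
theorem tendsto_bregman_div_sq (θ x : ℝ) :
    Tendsto (fun s => bregman θ (θ + x * s) / s ^ 2) (𝓝[≠] 0)
      (𝓝 (Real.sigmoid θ * (1 - Real.sigmoid θ) * x ^ 2 / 2)) := by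
  have haff : ∀ s : ℝ, HasDerivAt (fun s => θ + x * s) x s := fun s => by
    simpa using ((hasDerivAt_id s).const_mul x).const_add θ
  have hf : ∀ s : ℝ, HasDerivAt (fun s => bregman θ (θ + x * s))
      (x * (Real.sigmoid (θ + x * s) - Real.sigmoid θ)) s := by
    intro s
    have h1 := ((hasDerivAt_logPartition (θ + x * s)).comp s (haff s)).sub_const (logPartition θ)
    have h2 := ((haff s).sub_const θ).mul_const (Real.sigmoid θ)
    refine (h1.sub h2).congr_deriv ?_
    ring
  have hg : ∀ s : ℝ, HasDerivAt (fun s : ℝ => s ^ 2) (2 * s) s := fun s => by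
    simpa using hasDerivAt_pow 2 s
  refine HasDerivAt.lhopital_zero_nhdsNE (Eventually.of_forall hf) (Eventually.of_forall hg)
    ?_ ?_ ?_ ?_
  · filter_upwards [self_mem_nhdsWithin] with s hs
    exact mul_ne_zero two_ne_zero hs
  · have := (hf 0).continuousAt.tendsto
    simp only [mul_zero, add_zero] at this
    rw [show bregman θ θ = 0 by simp [bregman]] at this
    exact this.mono_left nhdsWithin_le_nhds
  · have := (hg 0).continuousAt.tendsto
    simp only [ne_eq, OfNat.ofNat_ne_zero, not_false_eq_true, zero_pow] at this
    exact this.mono_left nhdsWithin_le_nhds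
  · have hσ : HasDerivAt (fun s => Real.sigmoid (θ + x * s))
        (Real.sigmoid θ * (1 - Real.sigmoid θ) * x) 0 := by
      have h := (Real.hasDerivAt_sigmoid (θ + x * 0)).comp 0 (haff 0)
      rw [mul_zero, add_zero] at h
      exact h
    have h := (hasDerivAt_iff_tendsto_slope_zero.1 hσ).mul_const (x / 2)
    refine (h.congr' ?_).trans (le_of_eq ?_)
    · filter_upwards [self_mem_nhdsWithin] with s hs
      have hs : s ≠ 0 := hs
      simp only [zero_add, mul_zero, add_zero, smul_eq_mul]
      field_simp
    · congr 1
      ring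

/-- The Chernoff exponent is dominated by the `ω`-weighted divergences from `θ` only for
`ω = 1 / 2`: to second order at natural parameters `θ + (δ ± 1) s`, the domination reads
`0 ≤ 2 (2 ω - 1) δ + δ ^ 2`. -/
theorem eq_half_of_chernoff_le {θ ω : ℝ}
    (h : ∀ x y : ℝ, y < x → chernoff x y ≤ ω * bregman θ x + (1 - ω) * bregman θ y) :
    ω = 1 / 2 := by
  by_contra hne
  set κ := ω - 1 / 2 with hκ
  have hκ0 : κ ≠ 0 := sub_ne_zero.2 hne
  -- `δ = -κ` makes `4 * κ * δ + δ ^ 2` negative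
  set δ := -κ with hδ
  set v := Real.sigmoid θ * (1 - Real.sigmoid θ) with hv
  have hvpos : 0 < v :=
    mul_pos (Real.sigmoid_pos θ) (sub_pos.2 (Real.sigmoid_lt_one θ))
  have hlim := ((((tendsto_bregman_div_sq θ (δ + 1)).sub
    (tendsto_bregman_div_sq θ (δ - 1))).const_mul κ).add
    (tendsto_bregman_div_sq θ δ)).mono_left (nhdsGT_le_nhdsNE 0)
  have hnonneg : 0 ≤ κ * (v * (δ + 1) ^ 2 / 2 - v * (δ - 1) ^ 2 / 2) + v * δ ^ 2 / 2 := by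
    refine ge_of_tendsto hlim ?_
    filter_upwards [self_mem_nhdsWithin] with s hs
    have hs : 0 < s := hs
    have h1 := h (θ + (δ + 1) * s) (θ + (δ - 1) * s) (by linarith)
    rw [chernoff, show (θ + (δ + 1) * s + (θ + (δ - 1) * s)) / 2 = θ + δ * s by ring] at h1
    have h2 : 0 ≤ (κ * (bregman θ (θ + (δ + 1) * s) - bregman θ (θ + (δ - 1) * s)) +
        bregman θ (θ + δ * s)) / s ^ 2 := by
      refine div_nonneg ?_ (sq_nonneg s)
      simp only [bregman, hκ] at h1 ⊢
      linarith
    refine h2.trans (le_of_eq ?_)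
    ring
  have : 0 < κ ^ 2 := by positivity
  rw [hδ] at hnonneg
  nlinarith [mul_pos hvpos this]

end TwoArmBandit

theorem mainTheorem1 (U : TwoArmBandit.Algorithm) (hU : TwoArmBandit.IsUniformSampling U) :
    ¬ ∃ A : TwoArmBandit.Algorithm, TwoArmBandit.IsBetter A U := by
  open TwoArmBandit in
  rintro ⟨A, hA, μ, hlt⟩
  have hpos : ∀ π, 0 < errorExponent A π := by
    intro π
    obtain ⟨a, b, hπ⟩ : ∃ a b, π.mean b < π.mean a :=
      (lt_or_gt_of_ne π.mean_ne).elim (fun h => ⟨1, 0, h⟩) fun h => ⟨0, 1, h⟩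
    have h1 : (0 : EReal) < (chernoff (π.param a) (π.param b) : EReal) :=
      EReal.coe_pos.2 (chernoff_pos (π.mean_lt_mean_iff.1 hπ).ne')
    exact h1.trans_le ((chernoff_le_errorExponent hU π hπ).trans (hA π))
  obtain ⟨a, b, hμ⟩ : ∃ a b, μ.mean b < μ.mean a :=
    (lt_or_gt_of_ne μ.mean_ne).elim (fun h => ⟨1, 0, h⟩) fun h => ⟨0, 1, h⟩
  have hab : a ≠ b := fun h => hμ.ne (by rw [h])
  obtain ⟨ω, -, hω⟩ :=
    exists_proportion_diagonal A hpos hab ((μ.param a + μ.param b) / 2)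
  have hhalf : ω = 1 / 2 := by
    refine eq_half_of_chernoff_le (θ := (μ.param a + μ.param b) / 2)
      fun x y hyx => le_of_forall_lt_imp_le_of_dense fun c hc => ?_
    obtain ⟨ν, rfl, rfl⟩ := exists_param hab hyx.ne'
    have hν := ν.mean_lt_mean_iff.2 hyx
    exact hω ν hν c ((EReal.coe_lt_coe_iff.2 hc).trans_le
      ((chernoff_le_errorExponent hU ν hν).trans (hA ν)))
  obtain ⟨c, hc1, hc2⟩ := EReal.lt_iff_exists_real_btwn.1 hlt
  have h1 := hω μ hμ c hc2
  have h2 := EReal.coe_lt_coe_iff.1 ((chernoff_le_errorExponent hU μ hμ).trans_lt hc1)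
  rw [chernoff_eq_bregman] at h2
  rw [hhalf] at h1
  linarith
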